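/- Let $\overrightarrow{G}=(V,E)$ be a finite simple digraph on $n$ vertices (no loops, at most one edge from $u$ to $v$ for each ordered pair $(u,v)$; two opposite edges between the same vertices are allowed), and let $G$ be its underlying simple undirected graph, in which a pair of opposite edges becomes a single edge. A proper coloring is a map $\kappa$ from $V$ to the positive integers with $\kappa(u)\neq\kappa(v)$ whenever $u,v$ are adjacent in $G$, and $\operatorname{asc}(\kappa)$ is the number of directed edges $(u,v)\in E$ with $\kappa(u)<\kappa(v)$. Let $$X_{\overrightarrow{G}}(\mathbf{x},t)=\sum_{\kappa\text{ proper}}t^{\operatorname{asc}(\kappa)}\prod_{v\in V}x_{\kappa(v)},$$ a formal power series in $x_1,x_2,\dots$ with coefficients in $\mathbb{Q}[t]$. Suppose that $X_{\overrightarrow{G}}(\mathbf{x},t)$ is symmetric in the variables $x_1,x_2,\dots$, and that it has the expansion $$X_{\overrightarrow{G}}(\mathbf{x},t)=\sum_{\lambda\vdash n}c_\lambda(t)\,e_\lambda(\mathbf{x}),\qquad c_\lambda(t)\in\mathbb{Q}[t],$$ in the elementary symmetric functions $e_\lambda=\prod_i e_{\lambda_i}$. Then for every integer $k\ge 0$,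 $$\sum_{\substack{\lambda\vdash n\\ \ell(\lambda)=k}}c_\lambda(t)=\sum_{D\in AO_k(G)}t^{\operatorname{asc}_{\overrightarrow{G}}(D)},$$ where $\ell(\lambda)$ is the number of parts of $\lambda$, $AO_k(G)$ is the set of acyclic orientations of $G$ with exactly $k$ sinks (vertices with no outgoing edge), and $\operatorname{asc}_{\overrightarrow{G}}(D)$ is the number of directed edges of $\overrightarrow{G}$ that are oriented as in $D$. -/

import Mathlib

open scoped Polynomial

noncomputable section

namespace ChromaticQSym

/-- Proper colorings of a digraph by positive integers, i.e. proper colorings of its underlying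
undirected graph (a pair of opposite directed edges gives one undirected edge). -/
abbrev ProperColoring {V : Type*} (G : Digraph V) : Type _ :=
  G.toSimpleGraphInclusive.Coloring ℕ+

open Classical in
/-- The number of ascents of a coloring `κ`: directed edges `(u, v)` with `κ u < κ v`. -/
def asc {V : Type*} [Fintype V] (G : Digraph V) (κ : ProperColoring G) : ℕ :=
  (Finset.univ.filter fun p : V × V => G.Adj p.1 p.2 ∧ κ p.1 < κ p.2).card

/-- The exponent vector of the monomial `x_κ = ∏ v, x_{κ v}`. -/
def content {V : Type*} [Fintype V] {G : Digraph V} (κ : ProperColoring G) : ℕ+ →₀ ℕ :=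
  ∑ v, Finsupp.single (κ v) 1

/-- Only finitely many proper colorings `κ` have a given monomial `x_κ`. -/
theorem finite_content_eq {V : Type*} [Fintype V] (G : Digraph V) (m : ℕ+ →₀ ℕ) :
    {κ : ProperColoring G | content κ = m}.Finite := by
  classical
  have h : (Set.univ.pi fun _ : V => (m.support : Set ℕ+)).Finite :=
    Set.Finite.pi fun _ => m.support.finite_toSet
  refine Set.Finite.of_finite_image (f := fun κ : ProperColoring G => (κ : V → ℕ+))
    (h.subset ?_) (DFunLike.coe_injective.injOn)
  rintro _ ⟨κ, hκ, rfl⟩ v -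
  have hκ' : content κ = m := hκ
  have h1 : Finsupp.single (κ v) 1 (κ v) ≤ ∑ w, Finsupp.single (κ w) 1 (κ v) :=
    Finset.single_le_sum (f := fun w => Finsupp.single (κ w) 1 (κ v))
      (fun _ _ => Nat.zero_le _) (Finset.mem_univ v)
  have h2 : m (κ v) = ∑ w, Finsupp.single (κ w) 1 (κ v) := by
    rw [← hκ', content, Finsupp.finsetSum_apply]
  rw [Finsupp.single_eq_same] at h1
  simp only [Finset.mem_coe, Finsupp.mem_support_iff]
  omega

/-- The chromatic quasisymmetric function `∑_κ t ^ asc(κ) x_κ` of a finite digraph, a formal power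
series in `x₁, x₂, …` over `ℚ[t]`: the coefficient of a monomial `x ^ m` is the sum of `t ^ asc(κ)`
over the finitely many proper colorings `κ` with `x_κ = x ^ m`. -/
def chromQSym {V : Type*} [Fintype V] (G : Digraph V) : MvPowerSeries ℕ+ ℚ[X] :=
  fun m => ∑ κ ∈ (finite_content_eq G m).toFinset, (Polynomial.X : ℚ[X]) ^ asc G κ

/-- A power series is symmetric if it is invariant under all permutations of the variables. -/
def IsSymm {R : Type*} [Semiring R] (f : MvPowerSeries ℕ+ R) : Prop :=
  ∀ (σ : Equiv.Perm ℕ+) (m : ℕ+ →₀ ℕ),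
    MvPowerSeries.coeff (m.equivMapDomain σ) f = MvPowerSeries.coeff m f

open Classical in
/-- The elementary symmetric function `e_d`, the sum of the squarefree monomials `∏ i ∈ s, x_i`
over all `d`-element sets `s` of positive integers. -/
def elem (R : Type*) [CommSemiring R] (d : ℕ) : MvPowerSeries ℕ+ R :=
  fun m => if ∃ s : Finset ℕ+, s.card = d ∧ ∑ i ∈ s, Finsupp.single i 1 = m then 1 else 0

/-- The elementary symmetric function `e_μ = ∏ i, e_{μ_i}` of a partition `μ`. -/
def elemPart (R : Type*) [CommSemiring R] {n : ℕ} (μ : n.Partition) : MvPowerSeries ℕ+ R :=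
  (μ.parts.map (elem R)).prod

/-- `D` is an orientation of the simple graph `H`: every edge of `H` gets exactly one of its two
directions, and `D` has no other edges. -/
def IsOrientation {V : Type*} (H : SimpleGraph V) (D : Digraph V) : Prop :=
  (∀ u v, D.Adj u v → H.Adj u v) ∧ ∀ u v, H.Adj u v → Xor (D.Adj u v) (D.Adj v u)

/-- `D` has no directed cycles. -/
def IsAcyclic {V : Type*} (D : Digraph V) : Prop :=
  ∀ v, ¬ Relation.TransGen D.Adj v v

open Classical in
/-- The sinks of `D`: vertices without outgoing edges. -/
def sinks {V : Type*} [Fintype V] (D : Digraph V) : Finset V :=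
  Finset.univ.filter fun v => ∀ w, ¬ D.Adj v w

open Classical in
/-- The acyclic orientations of `H` with exactly `k` sinks. -/
def acyclicOrientations {V : Type*} [Fintype V] (H : SimpleGraph V) (k : ℕ) :
    Finset (Digraph V) :=
  Finset.univ.filter fun D => IsOrientation H D ∧ IsAcyclic D ∧ (sinks D).card = k

open Classical in
/-- The number of directed edges of `G` that are oriented as in `D`. -/
def ascOrientation {V : Type*} [Fintype V] (G D : Digraph V) : ℕ :=
  (Finset.univ.filter fun p : V × V => G.Adj p.1 p.2 ∧ D.Adj p.1 p.2).card

end ChromaticQSym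

end

/-! Specializing `x` to the point `(1, …, 1, 1 - y)` with `m` ones turns both sides of the expansion
into polynomials in `m`, which may be evaluated at `m = -1`. There the generating function of the
elementary symmetric functions becomes `1 - y u / (1 + u)`, so `e_λ` becomes `(-1) ^ n y ^ ℓ(λ)`. On
the other side, group the colorings by the acyclic orientation `D` towards the larger color. The
vertices of the last color form a set of sinks of `D`, weighted by powers of `1 - y`, and the
remaining colors contribute a strict order polynomial, whose value at `-1` is a sign by reciprocity.
Summing over the sets of sinks gives `(-1) ^ n y ^ #sinks`. Comparing coefficients of `y ^ k` yields
the theorem. -/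

namespace ChromaticQSym

open Finset

section Extrapolation

variable {R : Type*} [CommRing R]

theorem exists_comp_X_add_one_sub_self [Algebra ℚ R] (p : R[X]) :
    ∃ q : R[X], q.comp (Polynomial.X + 1) - q = p := by
  induction p using Polynomial.induction_on' with
  | add p₁ p₂ h₁ h₂ =>
    obtain ⟨q₁, rfl⟩ := h₁
    obtain ⟨q₂, rfl⟩ := h₂
    exact ⟨q₁ + q₂, by rw [Polynomial.add_comp]; ring⟩
  | monomial n a =>
    let B : R[X] := (Polynomial.bernoulli (n + 1)).map (algebraMap ℚ R)
    have hB : B.comp (Polynomial.X + 1) = B + ((n + 1 : ℕ) : R[X]) * Polynomial.X ^ n := by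
      simpa [B, Polynomial.map_comp, add_comm] using congrArg (Polynomial.map (algebraMap ℚ R))
        (Polynomial.bernoulli_comp_one_add_X (n + 1))
    have hinv : algebraMap ℚ R ((n + 1 : ℕ) : ℚ)⁻¹ * ((n + 1 : ℕ) : R) = 1 := by
      rw [← map_natCast (algebraMap ℚ R), ← map_mul, inv_mul_cancel₀ (by positivity), map_one]
    refine ⟨Polynomial.C (a * algebraMap ℚ R ((n + 1 : ℕ) : ℚ)⁻¹) * B, ?_⟩
    rw [Polynomial.mul_comp, Polynomial.C_comp, hB, mul_add, add_sub_cancel_left, ← mul_assoc,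
      ← map_natCast (Polynomial.C : R →+* R[X]), ← Polynomial.C_mul, mul_assoc a, hinv, mul_one,
      Polynomial.C_mul_X_pow_eq_monomial]

/-- The function `f` on the natural numbers is given by a polynomial whose value at `-1` is `a`.
This makes sense of evaluating `f` at `-1`. -/
def ExtrapolatesTo (f : ℕ → R) (a : R) : Prop :=
  ∃ p : R[X], (∀ m : ℕ, p.eval (m : R) = f m) ∧ p.eval (-1) = a

namespace ExtrapolatesTo

variable {f g : ℕ → R} {a b : R}

theorem const (a : R) : ExtrapolatesTo (fun _ => a) a :=
  ⟨Polynomial.C a, by simp, by simp⟩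

theorem add (hf : ExtrapolatesTo f a) (hg : ExtrapolatesTo g b) :
    ExtrapolatesTo (fun m => f m + g m) (a + b) := by
  obtain ⟨p, hp, rfl⟩ := hf
  obtain ⟨q, hq, rfl⟩ := hg
  exact ⟨p + q, by simp [hp, hq], by simp⟩

theorem mul (hf : ExtrapolatesTo f a) (hg : ExtrapolatesTo g b) :
    ExtrapolatesTo (fun m => f m * g m) (a * b) := by
  obtain ⟨p, hp, rfl⟩ := hf
  obtain ⟨q, hq, rfl⟩ := hg
  exact ⟨p * q, by simp [hp, hq], by simp⟩

theorem sum {ι : Type*} {s : Finset ι} {f : ι → ℕ → R} {a : ι → R}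
    (h : ∀ i ∈ s, ExtrapolatesTo (f i) (a i)) :
    ExtrapolatesTo (fun m => ∑ i ∈ s, f i m) (∑ i ∈ s, a i) := by
  choose! p hp ha using h
  exact ⟨∑ i ∈ s, p i,
    fun m => by rw [Polynomial.eval_finsetSum]; exact sum_congr rfl fun i hi => hp i hi m,
    by rw [Polynomial.eval_finsetSum]; exact sum_congr rfl ha⟩

theorem multiset_prod {ι : Type*} {s : Multiset ι} {f : ι → ℕ → R} {a : ι → R}
    (h : ∀ i ∈ s, ExtrapolatesTo (f i) (a i)) :
    ExtrapolatesTo (fun m => (s.map (f · m)).prod) (s.map a).prod := by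
  choose! p hp ha using h
  refine ⟨(s.map p).prod, fun m => ?_, ?_⟩ <;>
    rw [Polynomial.eval_multiset_prod, Multiset.map_map]
  · exact congrArg _ (Multiset.map_congr rfl fun i hi => hp i hi m)
  · exact congrArg _ (Multiset.map_congr rfl ha)

theorem of_diff [Algebra ℚ R] (hg : ExtrapolatesTo g a) (h : ∀ m, f (m + 1) = f m + g m) :
    ExtrapolatesTo f (f 0 - a) := by
  obtain ⟨p, hp, rfl⟩ := hg
  obtain ⟨q, rfl⟩ := exists_comp_X_add_one_sub_self p
  simp only [Polynomial.eval_sub, Polynomial.eval_comp, Polynomial.eval_add, Polynomial.eval_X,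
    Polynomial.eval_one] at hp
  refine ⟨q + Polynomial.C (f 0 - q.eval 0), fun m => ?_, ?_⟩
  · rw [Polynomial.eval_add, Polynomial.eval_C]
    induction m with
    | zero => simp
    | succ m ih =>
      rw [h, ← ih, ← hp m, Nat.cast_succ]
      ring
  · simp only [Polynomial.eval_sub, Polynomial.eval_add, Polynomial.eval_C,
      Polynomial.eval_comp, Polynomial.eval_X, Polynomial.eval_one, neg_add_cancel]
    ring

theorem unique [IsDomain R] [CharZero R] (ha : ExtrapolatesTo f a) (hb : ExtrapolatesTo f b) :
    a = b := by
  obtain ⟨p, hp, rfl⟩ := ha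
  obtain ⟨q, hq, rfl⟩ := hb
  rw [Polynomial.eq_of_infinite_eval_eq p q]
  refine (Set.infinite_range_of_injective (Nat.cast_injective (R := R))).mono ?_
  rintro _ ⟨m, rfl⟩
  exact (hp m).trans (hq m).symm

end ExtrapolatesTo

theorem extrapolatesTo_choose [Algebra ℚ R] (d : ℕ) :
    ExtrapolatesTo (fun m => (m.choose d : R)) ((-1) ^ d) := by
  induction d with
  | zero => simpa using ExtrapolatesTo.const (1 : R)
  | succ d ih =>
    have hpascal (m : ℕ) : ((m + 1).choose (d + 1) : R) = m.choose (d + 1) + m.choose d := by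
      rw [Nat.choose_succ_succ, Nat.cast_add, add_comm]
    simpa [pow_succ] using ih.of_diff (f := fun m => (m.choose (d + 1) : R)) hpascal

end Extrapolation

section ElementarySymmetric

theorem esymm_cons_succ {R : Type*} [CommSemiring R] (a : R) (s : Multiset R) (d : ℕ) :
    (a ::ₘ s).esymm (d + 1) = s.esymm (d + 1) + a * s.esymm d := by
  simp [Multiset.esymm, Multiset.powersetCard_cons, Multiset.sum_map_mul_left]

theorem esymm_replicate_one {R : Type*} [CommSemiring R] (m d : ℕ) :
    (Multiset.replicate m (1 : R)).esymm d = m.choose d := by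
  have h : ∀ t ∈ (Multiset.replicate m (1 : R)).powersetCard d, t.prod = 1 := fun t ht =>
    Multiset.prod_eq_one fun x hx => Multiset.eq_of_mem_replicate
      (Multiset.mem_of_le (Multiset.mem_powersetCard.1 ht).1 hx)
  simp [Multiset.esymm, Multiset.map_congr rfl h]

/-- `-1` variables equal to `1` and one equal to `1 - y` have the generating function
`(1 + (1 - y) u) / (1 + u) = 1 - y u / (1 + u)` of elementary symmetric functions. -/
theorem extrapolatesTo_esymm {R : Type*} [CommRing R] [Algebra ℚ R] (y : R) {d : ℕ} (hd : d ≠ 0) :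
    ExtrapolatesTo (fun m => ((1 - y) ::ₘ Multiset.replicate m 1).esymm d) ((-1) ^ d * y) := by
  obtain ⟨d, rfl⟩ := Nat.exists_eq_succ_of_ne_zero hd
  simp only [Nat.succ_eq_add_one, esymm_cons_succ, esymm_replicate_one]
  convert (extrapolatesTo_choose (d + 1)).add
    ((ExtrapolatesTo.const (1 - y)).mul (extrapolatesTo_choose d)) using 1
  ring

theorem prod_map_pow_eq_pow_sum {M : Type*} [CommMonoid M] (x : M) (s : Multiset ℕ) :
    (s.map (x ^ ·)).prod = x ^ s.sum := by
  induction s using Multiset.induction_on with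
  | empty => simp
  | cons d s ih => rw [Multiset.map_cons, Multiset.prod_cons, ih, Multiset.sum_cons, pow_add]

theorem extrapolatesTo_prod_esymm {R : Type*} [CommRing R] [Algebra ℚ R] (y : R) {n : ℕ}
    (μ : n.Partition) :
    ExtrapolatesTo (fun m => (μ.parts.map ((1 - y) ::ₘ Multiset.replicate m 1).esymm).prod)
      ((-1) ^ n * y ^ μ.parts.card) := by
  have hprod : (μ.parts.map fun d => (-1) ^ d * y).prod = (-1) ^ n * y ^ μ.parts.card := by
    rw [Multiset.prod_map_mul, prod_map_pow_eq_pow_sum, μ.parts_sum, Multiset.map_const',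
      Multiset.prod_replicate]
  rw [← hprod]
  exact ExtrapolatesTo.multiset_prod fun d hd => extrapolatesTo_esymm y (μ.parts_pos hd).ne'

end ElementarySymmetric

section Specialization

variable {σ ι R S : Type*} [CommRing R] [CommRing S] [Algebra R S]

theorem hasSubst_C_mul_X (a : σ →₀ S) :
    MvPowerSeries.HasSubst fun i => PowerSeries.C (a i) * PowerSeries.X where
  const_coeff i := by
    change IsNilpotent (PowerSeries.constantCoeff (PowerSeries.C (a i) * PowerSeries.X))
    simp
  coeff_zero d := a.hasFiniteSupport.subset fun i hi ha => hi (by simp [ha])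

/-- The specialization `x i ↦ a i * u` of power series at a finitely supported family `a`. The
variable `u` records the degree, so that infinite sums specialize to power series. -/
noncomputable def specialization (a : σ →₀ S) : MvPowerSeries σ R →ₐ[R] PowerSeries S :=
  MvPowerSeries.substAlgHom (hasSubst_C_mul_X a)

theorem coeff_specialization (a : σ →₀ S) (f : MvPowerSeries σ R) (n : ℕ) :
    PowerSeries.coeff n (specialization a f) =
      ∑ᶠ d : σ →₀ ℕ, MvPowerSeries.coeff d f •
        if n = d.degree then d.prod fun i k => a i ^ k else 0 := by
  have hprod (d : σ →₀ ℕ) : (d.prod fun i k => (PowerSeries.C (a i) * PowerSeries.X) ^ k) =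
      PowerSeries.monomial d.degree (d.prod fun i k => a i ^ k) := by
    simp only [mul_pow, Finsupp.prod_mul, ← map_pow]
    rw [PowerSeries.monomial_eq_C_mul_X_pow, Finsupp.prod, ← map_prod, Finsupp.prod, Finsupp.prod,
      prod_pow_eq_pow_sum, Finsupp.degree_apply]
  rw [PowerSeries.coeff, specialization, MvPowerSeries.substAlgHom_apply, MvPowerSeries.coeff_subst
    (hasSubst_C_mul_X a)]
  refine finsum_congr fun d => ?_
  rw [hprod, ← PowerSeries.coeff_monomial]
  rfl

theorem specialization_eq_monomial [DecidableEq σ] {a : σ →₀ S} {T : Finset σ} (hT : a.support ⊆ T)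
    {f : MvPowerSeries σ R} (F : Finset ι) (g : ι → σ →₀ ℕ) (r : ι → R)
    (hf : ∀ d : σ →₀ ℕ, d.support ⊆ T → MvPowerSeries.coeff d f = ∑ i ∈ F with g i = d, r i)
    {n : ℕ} (hg : ∀ i ∈ F, (g i).degree = n) :
    specialization a f =
      PowerSeries.monomial n (∑ i ∈ F, r i • (g i).prod fun j k => a j ^ k) := by
  ext e
  let M (d : σ →₀ ℕ) : S := if e = d.degree then d.prod fun j k => a j ^ k else 0
  have hterm (d : σ →₀ ℕ) :
      MvPowerSeries.coeff d f • M d = ∑ i ∈ F with g i = d, r i • M (g i) := by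
    rw [sum_congr rfl fun i hi => by rw [(mem_filter.1 hi).2], ← sum_smul]
    by_cases hd : d.support ⊆ T
    · rw [hf d hd]
    · obtain ⟨j, hj, hjT⟩ := not_subset.1 hd
      have hM : M d = 0 := by
        have : a j = 0 := Finsupp.notMem_support_iff.1 fun h => hjT (hT h)
        refine ite_eq_right_iff.2 fun _ => prod_eq_zero hj ?_
        simp only [this, zero_pow (Finsupp.mem_support_iff.1 hj)]
      rw [hM, smul_zero, smul_zero]
  have hsupport : (fun d => MvPowerSeries.coeff d f • M d).support ⊆ F.image g := fun d hd => by
    obtain ⟨i, hi, -⟩ := exists_ne_zero_of_sum_ne_zero ((hterm d).symm.trans_ne hd)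
    exact mem_image.2 ⟨i, mem_filter.1 hi⟩
  rw [coeff_specialization, finsum_eq_sum_of_support_subset _ hsupport,
    sum_congr rfl fun d _ => hterm d,
    sum_fiberwise_of_maps_to fun i hi => mem_image_of_mem g hi, PowerSeries.coeff_monomial]
  split_ifs with he
  · exact sum_congr rfl fun i hi => by simp only [M, hg i hi, he, if_true]
  · exact sum_eq_zero fun i hi => by simp only [M, hg i hi, he, if_false, smul_zero]

theorem degree_sum_single (s : Finset ι) (g : ι → σ) :
    (∑ i ∈ s, Finsupp.single (g i) 1).degree = s.card := by
  simp [map_sum]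

theorem prod_sum_single (s : Finset ι) (g : ι → σ) (a : σ → S) :
    ((∑ i ∈ s, Finsupp.single (g i) 1).prod fun i k => a i ^ k) = ∏ i ∈ s, a (g i) := by
  rw [← Finsupp.prod_finsetSum_index (by simp) (by simp [pow_add])]
  simp

theorem support_sum_single [DecidableEq σ] (s : Finset ι) (g : ι → σ) :
    (∑ i ∈ s, Finsupp.single (g i) 1 : σ →₀ ℕ).support = s.image g := by
  ext j
  simp [Finsupp.finsetSum_apply, Finsupp.single_apply]

theorem specialization_elem {a : ℕ+ →₀ S} {T : Finset ℕ+} (hT : a.support ⊆ T) (d : ℕ) :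
    specialization a (elem R d) = PowerSeries.monomial d ((T.val.map a).esymm d) := by
  rw [specialization_eq_monomial hT (T.powersetCard d) (fun s => ∑ i ∈ s, Finsupp.single i 1)
    (fun _ => 1) ?_ fun s hs => (degree_sum_single s id).trans (mem_powersetCard.1 hs).2]
  · simp only [one_smul, prod_sum_single, esymm_map_val]
  · intro x hx
    have hinj (s : Finset ℕ+) : (∑ i ∈ s, Finsupp.single i 1 : ℕ+ →₀ ℕ).support = s := by
      simpa using support_sum_single s id
    rw [MvPowerSeries.coeff_apply, elem]
    split_ifs with h
    · obtain ⟨s, hs, rfl⟩ := h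
      rw [hinj] at hx
      rw [sum_eq_single_of_mem s (by simp [hx, hs])]
      intro t ht hts
      exact absurd (by rw [← hinj t, ← hinj s, (mem_filter.1 ht).2]) hts
    · rw [filter_eq_empty_iff.2, sum_empty]
      exact fun s hs hsx => h ⟨s, (mem_powersetCard.1 hs).2, hsx⟩

theorem specialization_elemPart {a : ℕ+ →₀ S} {T : Finset ℕ+} (hT : a.support ⊆ T) {n : ℕ}
    (μ : n.Partition) :
    specialization a (elemPart R μ) =
      PowerSeries.monomial n (μ.parts.map (T.val.map a).esymm).prod := by
  rw [elemPart, map_multiset_prod, Multiset.map_map]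
  simp only [Function.comp_def, specialization_elem hT, PowerSeries.monomial_eq_C_mul_X_pow]
  rw [Multiset.prod_map_mul, prod_map_pow_eq_pow_sum, μ.parts_sum, map_multiset_prod,
    Multiset.map_map]
  rfl

theorem specialization_C (a : σ →₀ S) (r : R) :
    specialization a (MvPowerSeries.C r) = PowerSeries.C (algebraMap R S r) := by
  rw [MvPowerSeries.c_eq_algebraMap, AlgHom.commutes, PowerSeries.algebraMap_apply]

/-- The point `(1, …, 1, z, 0, 0, …)` with `m` entries equal to `1`. -/
noncomputable def onesThen (m : ℕ) (z : S) : ℕ+ →₀ S :=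
  Finsupp.onFinset (Iic m.succPNat)
    (fun i => if i < m.succPNat then 1 else if i = m.succPNat then z else 0)
    fun i hi => by
      rw [mem_Iic]
      by_contra h
      rw [not_le] at h
      exact hi (by rw [if_neg h.not_gt, if_neg h.ne'])

theorem support_onesThen_subset (m : ℕ) (z : S) : (onesThen m z).support ⊆ Iic m.succPNat :=
  Finsupp.support_onFinset_subset

theorem map_onesThen (m : ℕ) (z : S) :
    (Iic m.succPNat).val.map (onesThen m z) = z ::ₘ Multiset.replicate m 1 := by
  have hcard : (Iio m.succPNat).card = m := by
    have h : Iio m.succPNat = Ico 1 m.succPNat := by ext i; simp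
    rw [h]
    simp
  rw [← Iio_insert, insert_val_of_notMem (by simp), Multiset.map_cons]
  congr 1
  · simp [onesThen]
  · rw [Multiset.map_congr rfl (g := fun _ => 1), Multiset.map_const', card_val, hcard]
    exact fun i hi => if_pos (mem_Iio.1 (show i ∈ Iio m.succPNat from hi))

end Specialization

theorem sum_powerset_pow_mul_neg_one_pow {ι R : Type*} [CommRing R] [DecidableEq ι] (z : R)
    {T S : Finset ι} (hTS : T ⊆ S) :
    ∑ W ∈ T.powerset, z ^ W.card * (-1) ^ (S \ W).card = (-1) ^ S.card * (1 - z) ^ T.card := by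
  have hsplit : ∀ W ∈ T.powerset, z ^ W.card * (-1 : R) ^ (S \ W).card =
      (-1) ^ (S \ T).card * (z ^ W.card * (-1) ^ (T.card - W.card)) := fun W hW => by
    have hWT := mem_powerset.1 hW
    rw [← card_sdiff_of_subset hWT, mul_left_comm, ← pow_add,
      ← card_union_of_disjoint (disjoint_sdiff_self_left.mono_right sdiff_subset),
      sdiff_union_sdiff_cancel hTS hWT]
  rw [sum_congr rfl hsplit, ← mul_sum, sum_pow_mul_eq_add_pow,
    show z + -1 = -1 * (1 - z) by ring, mul_pow, ← mul_assoc, ← pow_add,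
    card_sdiff_add_card_eq_card hTS]

section StrictColorings

variable {V : Type*} [Fintype V]

open Classical in
/-- The colorings of the vertices of `S` by `1, …, m` that increase strictly along the edges of `D`
inside `S`. They are extended by `0` to maps on `V`. -/
noncomputable def strictColorings (D : Digraph V) (S : Finset V) (m : ℕ) : Finset (V → ℕ) :=
  {κ ∈ Fintype.piFinset fun _ => range (m + 1) |
    (∀ v, 0 < κ v ↔ v ∈ S) ∧ ∀ u v, v ∈ S → D.Adj u v → κ u < κ v}

open Classical in
/-- The vertices of `S` without outgoing edges inside `S`, i.e. the sinks of the subgraph of `D`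
induced on `S`. -/
noncomputable def sinksIn (D : Digraph V) (S : Finset V) : Finset V :=
  {v ∈ S | ∀ w ∈ S, ¬ D.Adj v w}

variable {D : Digraph V} {S : Finset V} {m : ℕ} {κ : V → ℕ}

theorem mem_strictColorings :
    κ ∈ strictColorings D S m ↔
      (∀ v, κ v ≤ m) ∧ (∀ v, 0 < κ v ↔ v ∈ S) ∧ ∀ u v, v ∈ S → D.Adj u v → κ u < κ v := by
  simp [strictColorings]

theorem mem_sinksIn {v : V} : v ∈ sinksIn D S ↔ v ∈ S ∧ ∀ w ∈ S, ¬ D.Adj v w := by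
  simp [sinksIn]

theorem sinksIn_subset (D : Digraph V) (S : Finset V) : sinksIn D S ⊆ S :=
  fun _ h => (mem_sinksIn.1 h).1

theorem sinksIn_univ (D : Digraph V) : sinksIn D univ = sinks D := by
  ext v
  simp [mem_sinksIn, sinks]

theorem IsAcyclic.sinksIn_nonempty (hD : IsAcyclic D) (hS : S.Nonempty) :
    (sinksIn D S).Nonempty := by
  have : IsTrans V (Function.swap (Relation.TransGen D.Adj)) := ⟨fun _ _ _ h₁ h₂ => h₂.trans h₁⟩
  have : Std.Irrefl (Function.swap (Relation.TransGen D.Adj)) := ⟨hD⟩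
  obtain ⟨v, hv, hmin⟩ := (Finite.wellFounded_of_trans_of_irrefl
    (Function.swap (Relation.TransGen D.Adj))).has_min (S : Set V) hS
  exact ⟨v, mem_sinksIn.2 ⟨hv, fun w hw h => hmin w hw (Relation.TransGen.single h)⟩⟩

theorem strictColorings_empty : strictColorings D ∅ m = {0} := by
  ext κ
  simp +contextual [mem_strictColorings, funext_iff]

theorem strictColorings_zero (hS : S.Nonempty) : strictColorings D S 0 = ∅ := by
  obtain ⟨v, hv⟩ := hS
  refine eq_empty_of_forall_notMem fun κ hκ => ?_
  obtain ⟨hle, hpos, -⟩ := mem_strictColorings.1 hκ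
  exact (hle v).not_gt ((hpos v).2 hv)

theorem filter_eq_succ_subset_sinksIn (hκ : κ ∈ strictColorings D S (m + 1)) :
    ({v | κ v = m + 1} : Finset V) ⊆ sinksIn D S := by
  obtain ⟨hle, hpos, hlt⟩ := mem_strictColorings.1 hκ
  intro v hv
  rw [mem_filter_univ] at hv
  refine mem_sinksIn.2 ⟨(hpos v).1 (by omega), fun w hw hvw => ?_⟩
  have := hlt v w hw hvw
  have := hle w
  omega

open Classical in
theorem card_filter_strictColorings {W : Finset V} (hW : W ⊆ sinksIn D S) :
    #{κ ∈ strictColorings D S (m + 1) | ({v | κ v = m + 1} : Finset V) = W} =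
      #(strictColorings D (S \ W) m) := by
  have hWS (v : V) (hv : v ∈ W) : v ∈ S ∧ ∀ w ∈ S, ¬ D.Adj v w := mem_sinksIn.1 (hW hv)
  refine card_nbij' (fun κ v => if v ∈ W then 0 else κ v)
    (fun κ v => if v ∈ W then m + 1 else κ v) ?_ ?_ ?_ ?_
  all_goals
    intro κ hκ
    simp only [coe_filter, Set.mem_ofPred_eq, mem_coe, mem_strictColorings, mem_sdiff,
      Finset.ext_iff, mem_filter_univ, funext_iff] at hκ ⊢
    grind

open Classical in
/-- The vertices of the largest color form a set of sinks, and removing them leaves a strict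
coloring with one color less. -/
theorem sum_strictColorings_succ {R : Type*} [CommSemiring R] (z : R) (D : Digraph V)
    (S : Finset V) (m : ℕ) :
    ∑ κ ∈ strictColorings D S (m + 1), z ^ #{v | κ v = m + 1} =
      ∑ W ∈ (sinksIn D S).powerset, z ^ #W * (#(strictColorings D (S \ W) m) : R) := by
  rw [← sum_fiberwise_of_maps_to (g := fun κ : V → ℕ => ({v | κ v = m + 1} : Finset V))
    fun κ hκ => mem_powerset.2 (filter_eq_succ_subset_sinksIn hκ)]
  refine sum_congr rfl fun W hW => ?_
  rw [sum_congr rfl fun κ hκ => by rw [(mem_filter.1 hκ).2], sum_const,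
    card_filter_strictColorings (mem_powerset.1 hW), nsmul_eq_mul, mul_comm]

variable {R : Type*} [CommRing R] [Algebra ℚ R]

/-- Reciprocity at `-1`: the recursion over sets of sinks becomes an alternating sum, which vanishes
because a nonempty acyclic digraph has a sink. -/
theorem IsAcyclic.extrapolatesTo_card_strictColorings (hD : IsAcyclic D) (S : Finset V) :
    ExtrapolatesTo (fun m => (#(strictColorings D S m) : R)) ((-1) ^ #S) := by
  classical
  induction S using Finset.strongInduction with
  | H S ih =>
    rcases S.eq_empty_or_nonempty with rfl | hS
    · simpa [strictColorings_empty] using ExtrapolatesTo.const (1 : R)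
    have hempty : ∅ ∈ (sinksIn D S).powerset := empty_mem_powerset _
    have hdiff (m : ℕ) : (#(strictColorings D S (m + 1)) : R) = #(strictColorings D S m) +
        ∑ W ∈ (sinksIn D S).powerset.erase ∅, (#(strictColorings D (S \ W) m) : R) := by
      have := sum_strictColorings_succ (1 : R) D S m
      rw [← add_sum_erase _ _ hempty] at this
      simpa using this
    have hsum : ∑ W ∈ (sinksIn D S).powerset.erase ∅, (-1 : R) ^ #(S \ W) = -(-1) ^ #S := by
      have := sum_powerset_pow_mul_neg_one_pow (1 : R) (sinksIn_subset D S)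
      rw [sub_self, zero_pow (hD.sinksIn_nonempty hS).card_pos.ne', mul_zero,
        ← add_sum_erase _ _ hempty] at this
      simpa [eq_neg_iff_add_eq_zero, add_comm] using this
    have hproper : ∀ W ∈ (sinksIn D S).powerset.erase ∅, S \ W ⊂ S := fun W hW => by
      rw [mem_erase, mem_powerset] at hW
      exact sdiff_ssubset (hW.2.trans (sinksIn_subset D S)) (nonempty_iff_ne_empty.2 hW.1)
    simpa [strictColorings_zero hS, hsum] using
      (ExtrapolatesTo.sum fun W hW => ih _ (hproper W hW)).of_diff
        (f := fun m => (#(strictColorings D S m) : R)) hdiff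

open Classical in
theorem IsAcyclic.extrapolatesTo_sum_strictColorings (hD : IsAcyclic D) (y : R) :
    ExtrapolatesTo
      (fun m => ∑ κ ∈ strictColorings D univ (m + 1), (1 - y) ^ #{v | κ v = m + 1})
      ((-1) ^ Fintype.card V * y ^ #(sinks D)) := by
  have hsum := sum_powerset_pow_mul_neg_one_pow (1 - y) (subset_univ (sinksIn D univ))
  rw [sub_sub_cancel, sinksIn_univ, card_univ] at hsum
  simp only [sum_strictColorings_succ, sinksIn_univ, ← hsum]
  exact ExtrapolatesTo.sum fun W _ =>
    (ExtrapolatesTo.const _).mul (hD.extrapolatesTo_card_strictColorings _)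

end StrictColorings

section Orientations

variable {V : Type*}

/-- The orientation of the edges of `H` towards the larger value of `κ`. -/
def orientationOf {α : Type*} [LT α] (H : SimpleGraph V) (κ : V → α) : Digraph V where
  Adj u v := H.Adj u v ∧ κ u < κ v

theorem isAcyclic_orientationOf {α : Type*} [Preorder α] (H : SimpleGraph V) (κ : V → α) :
    IsAcyclic (orientationOf H κ) := by
  have hlt (u v : V) (h : Relation.TransGen (orientationOf H κ).Adj u v) : κ u < κ v := by
    induction h with
    | single h => exact h.2
    | tail _ h ih => exact ih.trans h.2
  exact fun v hv => lt_irrefl _ (hlt v v hv)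

theorem isOrientation_orientationOf {α : Type*} [LinearOrder α] {H : SimpleGraph V}
    (κ : H.Coloring α) : IsOrientation H (orientationOf H κ) := by
  refine ⟨fun u v h => h.1, fun u v huv => ?_⟩
  rcases (κ.valid huv).lt_or_gt with h | h
  · exact Or.inl ⟨⟨huv, h⟩, fun h' => h.asymm h'.2⟩
  · exact Or.inr ⟨⟨huv.symm, h⟩, fun h' => h.asymm h'.2⟩

theorem IsOrientation.eq_orientationOf {α : Type*} [Preorder α] {H : SimpleGraph V}
    {D : Digraph V} (hD : IsOrientation H D) {κ : V → α} (hκ : ∀ u v, D.Adj u v → κ u < κ v) :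
    D = orientationOf H κ := by
  ext u v
  refine ⟨fun h => ⟨hD.1 u v h, hκ u v h⟩, fun ⟨huv, hlt⟩ => ?_⟩
  rcases hD.2 u v huv with h | h
  · exact h.1
  · exact absurd (hκ v u h.1) hlt.asymm

theorem asc_eq_ascOrientation [Fintype V] {G : Digraph V} (κ : ProperColoring G) :
    asc G κ = ascOrientation G (orientationOf G.toSimpleGraphInclusive κ) := by
  classical
  refine congrArg card (filter_congr fun ⟨u, v⟩ _ => ?_)
  refine and_congr_right fun huv => ⟨fun hlt => ⟨?_, hlt⟩, fun h => h.2⟩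
  exact (SimpleGraph.fromRel_adj _ _ _).2 ⟨fun h => hlt.ne (congrArg κ h), Or.inl huv⟩

end Orientations

section Colorings

variable {V : Type*}

theorem finite_coloring_le [Finite V] (G : Digraph V) (N : ℕ+) :
    {κ : ProperColoring G | ∀ v, κ v ≤ N}.Finite :=
  Set.Finite.of_finite_image (f := fun κ : ProperColoring G => (κ : V → ℕ+))
    ((Set.Finite.pi fun _ : V => Set.finite_Iic N).subset
      fun _ ⟨_, hκ, h⟩ v _ => h ▸ hκ v) DFunLike.coe_injective.injOn

variable [Fintype V]

open Classical in
theorem specialization_chromQSym {S : Type*} [CommRing S] [Algebra ℚ[X] S] {a : ℕ+ →₀ S} {N : ℕ+}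
    (ha : a.support ⊆ Iic N) (G : Digraph V) :
    specialization a (chromQSym G) = PowerSeries.monomial (Fintype.card V)
      (∑ κ ∈ (finite_coloring_le G N).toFinset,
        algebraMap ℚ[X] S Polynomial.X ^ asc G κ * ∏ v, a (κ v)) := by
  rw [specialization_eq_monomial ha (finite_coloring_le G N).toFinset content
    (fun κ => Polynomial.X ^ asc G κ) ?_
    fun κ _ => degree_sum_single univ κ]
  · simp only [content, prod_sum_single, Algebra.smul_def, map_pow, card_univ]
  · intro d hd
    rw [MvPowerSeries.coeff_apply, chromQSym]
    refine sum_congr ?_ fun _ _ => rfl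
    ext κ
    simp only [Set.Finite.mem_toFinset, Set.mem_ofPred_eq, mem_filter]
    refine (and_iff_right_of_imp fun h v => mem_Iic.1 (hd ?_)).symm
    rw [← h, content, support_sum_single]
    exact mem_image_of_mem κ (mem_univ v)

open Classical in
/-- Each proper coloring is a strict coloring of exactly one acyclic orientation. -/
theorem sum_coloring_eq_sum_orientation {M : Type*} [AddCommMonoid M] (G : Digraph V) (N : ℕ+)
    (w : Digraph V → (V → ℕ) → M) :
    ∑ κ ∈ (finite_coloring_le G N).toFinset,
        w (orientationOf G.toSimpleGraphInclusive κ) (fun v => κ v) =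
      ∑ D with IsOrientation G.toSimpleGraphInclusive D ∧ IsAcyclic D,
        ∑ κ ∈ strictColorings D univ N, w D κ := by
  rw [sum_sigma']
  refine sum_bij (fun κ _ => ⟨orientationOf G.toSimpleGraphInclusive κ, fun v => κ v⟩) ?_ ?_ ?_ ?_
  · intro κ hκ
    rw [Set.Finite.mem_toFinset] at hκ
    simp only [mem_sigma, mem_filter_univ, mem_strictColorings]
    exact ⟨⟨isOrientation_orientationOf κ, isAcyclic_orientationOf _ _⟩, hκ,
      fun v => iff_of_true (κ v).pos (mem_univ v), fun u v _ h => h.2⟩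
  · intro κ₁ _ κ₂ _ h
    have h' := congrArg Sigma.snd h
    exact DFunLike.ext _ _ fun v => PNat.coe_injective (congrFun h' v)
  · rintro ⟨D, κ⟩ h
    simp only [mem_sigma, mem_filter_univ, mem_strictColorings, mem_univ, iff_true,
      forall_const] at h
    obtain ⟨⟨hD, -⟩, hle, hpos, hlt⟩ := h
    let κ' : V → ℕ+ := fun v => ⟨κ v, hpos v⟩
    have hD' : D = orientationOf G.toSimpleGraphInclusive κ' := hD.eq_orientationOf hlt
    have hproper {u v : V} (huv : G.toSimpleGraphInclusive.Adj u v) : κ' u ≠ κ' v := by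
      rcases hD.2 u v huv with h | h
      · exact (show κ' u < κ' v from hlt u v h.1).ne
      · exact (show κ' v < κ' u from hlt v u h.1).ne'
    refine ⟨SimpleGraph.Coloring.mk κ' hproper, (Set.Finite.mem_toFinset _).2 hle, ?_⟩
    exact Sigma.ext hD'.symm HEq.rfl
  · exact fun _ _ => rfl

end Colorings

section Identity

variable {V : Type*} [Fintype V] {S : Type*} [CommRing S]

open Classical in
theorem prod_onesThen {m : ℕ} (z : S) {κ : V → ℕ+} (hκ : ∀ v, κ v ≤ m.succPNat) :
    ∏ v, onesThen m z (κ v) = z ^ #{v | (κ v : ℕ) = m + 1} := by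
  rw [← prod_const, prod_filter]
  refine prod_congr rfl fun v _ => ?_
  have hlast : (κ v : ℕ) = m + 1 ↔ κ v = m.succPNat := by
    rw [← PNat.coe_inj, Nat.succPNat_coe]
  rcases (hκ v).lt_or_eq with h | h
  · rw [if_neg (mt hlast.1 h.ne)]
    exact if_pos h
  · rw [if_pos (hlast.2 h), h]
    simp [onesThen]

variable [Algebra ℚ[X] S] {G : Digraph V} {c : (Fintype.card V).Partition → ℚ[X]}

open Classical in
theorem sum_prod_esymm_eq_sum_strictColorings
    (hc : chromQSym G = ∑ μ, MvPowerSeries.C (c μ) * elemPart ℚ[X] μ) (m : ℕ) (z : S) :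
    ∑ μ, algebraMap ℚ[X] S (c μ) * (μ.parts.map (z ::ₘ Multiset.replicate m 1).esymm).prod =
      ∑ D with IsOrientation G.toSimpleGraphInclusive D ∧ IsAcyclic D,
        algebraMap ℚ[X] S Polynomial.X ^ ascOrientation G D *
          ∑ κ ∈ strictColorings D univ (m + 1), z ^ #{v | κ v = m + 1} := by
  have hsupp := support_onesThen_subset m z
  have h := congrArg (PowerSeries.coeff (Fintype.card V) ∘ specialization (onesThen m z)) hc
  simp only [Function.comp_apply, map_sum, map_mul, specialization_C, specialization_elemPart hsupp,
    specialization_chromQSym hsupp, map_onesThen, PowerSeries.coeff_C_mul,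
    PowerSeries.coeff_monomial_same] at h
  rw [← h]
  simp only [mul_sum]
  refine .trans (sum_congr rfl fun κ hκ => ?_) (sum_coloring_eq_sum_orientation G m.succPNat
    fun D κ => algebraMap ℚ[X] S Polynomial.X ^ ascOrientation G D * z ^ #{v | κ v = m + 1})
  rw [prod_onesThen z ((Set.Finite.mem_toFinset _).1 hκ), asc_eq_ascOrientation]

open Classical in
theorem sum_mul_pow_card_parts_eq_sum_mul_pow_card_sinks [IsDomain S] [CharZero S] [Algebra ℚ S]
    (hc : chromQSym G = ∑ μ, MvPowerSeries.C (c μ) * elemPart ℚ[X] μ) (y : S) :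
    ∑ μ, algebraMap ℚ[X] S (c μ) * y ^ μ.parts.card =
      ∑ D with IsOrientation G.toSimpleGraphInclusive D ∧ IsAcyclic D,
        algebraMap ℚ[X] S Polynomial.X ^ ascOrientation G D * y ^ #(sinks D) := by
  have hleft := ExtrapolatesTo.sum (s := univ) fun μ _ =>
    (ExtrapolatesTo.const (algebraMap ℚ[X] S (c μ))).mul (extrapolatesTo_prod_esymm y μ)
  have hright := ExtrapolatesTo.sum
    (s := {D | IsOrientation G.toSimpleGraphInclusive D ∧ IsAcyclic D}) fun D hD =>
      (ExtrapolatesTo.const (algebraMap ℚ[X] S Polynomial.X ^ ascOrientation G D)).mul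
        ((mem_filter.1 hD).2.2.extrapolatesTo_sum_strictColorings y)
  simp only [sum_prod_esymm_eq_sum_strictColorings hc] at hleft
  have h := hleft.unique hright
  simp only [mul_left_comm _ ((-1 : S) ^ Fintype.card V), ← mul_sum] at h
  exact (isUnit_one.neg.pow _).mul_right_inj.1 h

end Identity

end ChromaticQSym

theorem theorem6p5 {V : Type*} [Fintype V] (G : Digraph V) (hloop : ∀ v, ¬ G.Adj v v)
    (hsymm : ChromaticQSym.IsSymm (ChromaticQSym.chromQSym G))
    (c : (Fintype.card V).Partition → ℚ[X])
    (hc : ChromaticQSym.chromQSym G =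
      ∑ μ, MvPowerSeries.C (c μ) * ChromaticQSym.elemPart ℚ[X] μ)
    (k : ℕ) :
    ∑ μ : (Fintype.card V).Partition with μ.parts.card = k, c μ =
      ∑ D ∈ ChromaticQSym.acyclicOrientations G.toSimpleGraphInclusive k,
        (Polynomial.X : ℚ[X]) ^ ChromaticQSym.ascOrientation G D := by
  classical
  have hcoeff := congrArg (Polynomial.coeff · k)
    (ChromaticQSym.sum_mul_pow_card_parts_eq_sum_mul_pow_card_sinks hc (S := ℚ[X][X])
      Polynomial.X)
  simp only [Polynomial.finsetSum_coeff, Polynomial.algebraMap_apply, Algebra.algebraMap_self,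
    RingHom.id_apply, ← Polynomial.C_pow, Polynomial.coeff_C_mul, Polynomial.coeff_X_pow,
    mul_ite, mul_one, mul_zero, eq_comm (a := k), ← Finset.sum_filter,
    Finset.filter_filter] at hcoeff
  simpa only [ChromaticQSym.acyclicOrientations, and_assoc] using hcoeff
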